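/- Let $p$ be a prime. For positive integers $k,M$ let $S_{k,M}=\{z\in\{0,\dots,p-1\}^M : z_1+\cdots+z_M<k\}$ (addition in $\mathbb{Z}$), and let $\Phi_{k,M}$ be the system of linear forms $\phi_z(x,t_1,\dots,t_M)=x+z_1t_1+\cdots+z_Mt_M$, $z\in S_{k,M}$, over $\mathbb{F}_p$. For a system $\Psi=(\psi_i)_{i\in I}$ of finitely many linear forms in $d$ variables over $\mathbb{F}_p$ and functions $f_i:\mathbb{F}_p^n\to\mathbb{C}$, put $\Lambda_\Psi((f_i)_{i\in I})=\mathbb{E}_{x_1,\dots,x_d\in\mathbb{F}_p^n}\prod_{i\in I}f_i(\psi_i(x_1,\dots,x_d))$. For $d\ge 1$ let $\|f\|_{U^d}=\big(\mathbb{E}_{x,h_1,\dots,h_d\in\mathbb{F}_p^n}\prod_{\omega\in\{0,1\}^d}\mathcal{C}^{|\omega|}f(x+\omega_1h_1+\cdots+\omega_dh_d)\big)^{1/2^d}$ be the Gowers (semi)norm, where $\mathcal{C}$ is complex conjugation, and put $\|f\|_{U^0}=|\mathbb{E}f|$. A function is 1-bounded if its modulus is at most $1$ everywhere. For an integer $s\ge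 0$, the system $\Psi$ has true complexity at most $s$ if there is a function $\varepsilon:\mathbb{R}_{>0}\to\mathbb{R}_{>0}$, extended by $\varepsilon(0)=0$, with $\varepsilon(\delta)\to 0$ as $\delta\to 0$, such that for every $n$ and all 1-bounded $f_i:\mathbb{F}_p^n\to\mathbb{C}$ one has $|\Lambda_\Psi((f_i)_{i\in I})|\le\min_{i\in I}\varepsilon(\|f_i\|_{U^{s+1}})$; its true complexity is the least such $s\ge 0$. **Theorem.** Let $p$ be a prime, $M\ge 1$, and $1\le k\le M(p-1)+1$. 1. If $k\ge 2$, then $\Phi_{k,M}$ has true complexity exactly $k-2$. 2. There is a constant $c=c_{k,M,p}\in(0,1]$, which can be taken to be $c=1$ if $k\le p$ and $c=2^{1-|S_{k,M}|}$ if $k>p$, such that for every $n$ and every collection of 1-bounded functions $(f_z:\mathbb{F}_p^n\to\mathbb{C})_{z\in S_{k,M}}$, $$\big|\Lambda_{\Phi_{k,M}}\big((f_z)_{z\in S_{k,M}}\big)\big|\le\min_{z\in S_{k,M}}\|f_z\|_{U^{k-1}}^{c}.$$ -/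

import Mathlib

open scoped BigOperators Topology

noncomputable section

/-- The Gowers norm `‖f‖_{U^d}` of a function on a finite abelian group `G`: the `2 ^ d`-th root of
the average over `x, h₁, …, h_d` of the product over `ω ⊆ {1, …, d}` of
`C^{|ω|} f (x + ∑_{i ∈ ω} h_i)`, with `C` complex conjugation. For `d ≥ 1` this average is a
nonnegative real, so that the modulus changes nothing; for `d = 0` the value is `|𝔼 f|`. -/
def gowersNorm {G : Type*} [AddCommGroup G] [Fintype G] (d : ℕ) (f : G → ℂ) : ℝ :=
  ‖𝔼 x : G, 𝔼 h : Fin d → G,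
    ∏ ω : Finset (Fin d), (starRingEnd ℂ)^[ω.card] (f (x + ∑ i ∈ ω, h i))‖ ^ ((1 : ℝ) / 2 ^ d)

/-- A complex-valued function is 1-bounded if its modulus is at most 1 everywhere. -/
def OneBounded {X : Type*} (f : X → ℂ) : Prop := ∀ x, ‖f x‖ ≤ 1

/-- A system of linear forms in `d` variables over `𝔽_p`, indexed by `ι`, is the family `Ψ` of its
coefficient vectors. This is the average `Λ_Ψ` of functions `f i` on `𝔽_p ^ n`. -/
def systemAverage {p : ℕ} [Fact p.Prime] {ι : Type*} [Fintype ι] {d : ℕ}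
    (Ψ : ι → Fin d → ZMod p) {n : ℕ} (f : ι → (Fin n → ZMod p) → ℂ) : ℂ :=
  𝔼 x : Fin d → Fin n → ZMod p, ∏ i, f i (∑ j, Ψ i j • x j)

/-- `Ψ` has true complexity at most `s`: there is `ε` with `ε(δ) → 0` as `δ → 0`, independent of the
dimension `n`, such that `|Λ_Ψ(f)| ≤ ε(‖f i‖_{U^{s+1}})` for every `i` and all 1-bounded functions
on `𝔽_p ^ n`. The function `ε` is extended to norm `0` by its limit `0`. -/
def TrueComplexityAtMost {p : ℕ} [Fact p.Prime] {ι : Type*} [Fintype ι] {d : ℕ}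
    (Ψ : ι → Fin d → ZMod p) (s : ℕ) : Prop :=
  ∃ ε : ℝ → ℝ, (∀ δ, 0 < δ → 0 < ε δ) ∧ ε 0 = 0 ∧ Filter.Tendsto ε (𝓝[>] 0) (𝓝 0) ∧
    ∀ (n : ℕ) (f : ι → (Fin n → ZMod p) → ℂ), (∀ i, OneBounded (f i)) →
      ∀ i, ‖systemAverage Ψ f‖ ≤ ε (gowersNorm (s + 1) (f i))

/-- `Ψ` has true complexity (exactly) `s`: `s` is the least nonnegative integer such that `Ψ` has
true complexity at most `s`. -/
def HasTrueComplexity {p : ℕ} [Fact p.Prime] {ι : Type*} [Fintype ι] {d : ℕ}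
    (Ψ : ι → Fin d → ZMod p) (s : ℕ) : Prop :=
  IsLeast {s : ℕ | TrueComplexityAtMost Ψ s} s

/-- `S_{k,M} = {z ∈ [0, p-1]^M : z₁ + ⋯ + z_M < k}`, with addition in the integers. -/
def progressionIndex (p k M : ℕ) : Finset (Fin M → Fin p) :=
  Finset.univ.filter fun z => ∑ j, (z j : ℕ) < k

/-- The system `Φ_{k,M}` of the forms `x + z₁ t₁ + ⋯ + z_M t_M` in the variables `x, t₁, …, t_M`,
for `z ∈ S_{k,M}`. -/
def progressionSystem (p k M : ℕ) : progressionIndex p k M → Fin (M + 1) → ZMod p :=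
  fun z => Fin.cons 1 fun j => (((z : Fin M → Fin p) j : ℕ) : ZMod p)

end

/-! Upper bound. Single out `z` and write the average as `𝔼 y, f z y * dualFunction P f z y`. If `k
- 1` affine hyperplanes missing `z` cover the other points, translating `t` along their coefficient
vectors by new variables `v i` makes each factor of the dual function invariant under some shear
`(y, v i) ↦ (y + a, v i - a)`, and Gowers–Cauchy–Schwarz bounds the average by the `U^{k-1}` norm of
`f z`. For `k ≤ p` such hyperplanes exist (`exists_hyperplane_cover`). For `k > p` those given by
the sum of coordinates may fail, since sums are seen only modulo `p`, but the hyperplanes `w j = i`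
with `i < z j` still cover every other point of weight at most that of `z`. So the heaviest points
go first (`norm_systemAverage_le_of_cover`): one Cauchy–Schwarz replaces a function by its
conjugated dual function, which is `Structured` and needs no hyperplane afterwards. At most `|S| -
1` squarings occur, whence `c = 2^{1-|S|}`.

Lower bound. An iterated forward difference of order `a` with `∑ a j = k - 1` kills polynomials of
degree `r < k - 1`. Multiplying one such polynomial by the difference coefficients gives phases
whose average is 1, although at `a` the phase of `N` disjoint monomials of degree `r` has `U^r` norm
`ρ ^ N` with `ρ < 1`. -/

noncomputable section

/-! ### Averages and Cauchy–Schwarz. -/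

section Expect

lemma expect_add_right_eq {G : Type*} [AddCommGroup G] [Fintype G] (F : G → ℂ) (a : G) :
    𝔼 x, F (x + a) = 𝔼 x, F x :=
  Fintype.expect_equiv (Equiv.addRight a) _ _ fun _ => rfl

lemma expect_sub_left_eq {G : Type*} [AddCommGroup G] [Fintype G] (F : G → ℂ) (a : G) :
    𝔼 x, F (a - x) = 𝔼 x, F x :=
  Fintype.expect_equiv (Equiv.subLeft a) _ _ fun _ => rfl

lemma expect_fin_cons {G : Type*} [Fintype G] {d : ℕ} (F : (Fin (d + 1) → G) → ℂ) :
    𝔼 v, F v = 𝔼 u, 𝔼 w : Fin d → G, F (Fin.cons u w) := by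
  rw [← Finset.expect_product' (f := fun u w => F (Fin.cons u w)), Finset.univ_product_univ]
  exact (Fintype.expect_equiv (Fin.consEquiv fun _ => G) _ _ fun _ => rfl).symm

lemma norm_expect_le_one {ι : Type*} [Fintype ι] {f : ι → ℂ} (hf : ∀ i, ‖f i‖ ≤ 1) :
    ‖𝔼 i, f i‖ ≤ 1 := by
  rcases isEmpty_or_nonempty ι with h | h
  · simp [Finset.expect]
  · exact (RCLike.norm_expect_le (K := ℂ)).trans
      (Finset.expect_le Finset.univ_nonempty fun i _ => hf i)

lemma expect_sq_le {ι : Type*} [Fintype ι] (f : ι → ℝ) : (𝔼 i, f i) ^ 2 ≤ 𝔼 i, f i ^ 2 := by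
  rcases isEmpty_or_nonempty ι with h | h
  · simp [Finset.expect]
  · simpa using Finset.expect_mul_sq_le_sq_mul_sq Finset.univ f fun _ => 1

lemma expect_pow_two_pow_le {ι : Type*} [Fintype ι] (f : ι → ℝ) (hf : ∀ i, 0 ≤ f i) (d : ℕ) :
    (𝔼 i, f i) ^ 2 ^ d ≤ 𝔼 i, f i ^ 2 ^ d := by
  induction d with
  | zero => simp
  | succ d ih =>
    have h0 : 0 ≤ 𝔼 i, f i := Finset.expect_nonneg fun i _ => hf i
    calc (𝔼 i, f i) ^ 2 ^ (d + 1) = ((𝔼 i, f i) ^ 2 ^ d) ^ 2 := by rw [pow_succ, pow_mul]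
      _ ≤ (𝔼 i, f i ^ 2 ^ d) ^ 2 := by gcongr
      _ ≤ 𝔼 i, (f i ^ 2 ^ d) ^ 2 := expect_sq_le _
      _ = _ := Finset.expect_congr rfl fun i _ => by rw [← pow_mul, ← pow_succ]

lemma norm_expect_mul_sq_le {ι : Type*} [Fintype ι] {a : ι → ℂ} (b : ι → ℂ)
    (ha : ∀ i, ‖a i‖ ≤ 1) : ‖𝔼 i, a i * b i‖ ^ 2 ≤ 𝔼 i, ‖b i‖ ^ 2 := by
  have h : ‖𝔼 i, a i * b i‖ ≤ 𝔼 i, ‖b i‖ := by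
    refine (RCLike.norm_expect_le (K := ℂ)).trans (Finset.expect_le_expect fun i _ => ?_)
    rw [norm_mul]
    exact mul_le_of_le_one_left (norm_nonneg _) (ha i)
  calc ‖𝔼 i, a i * b i‖ ^ 2 ≤ (𝔼 i, ‖b i‖) ^ 2 := by gcongr
    _ ≤ _ := expect_sq_le _

end Expect

/-! ### Gowers norms and the Gowers–Cauchy–Schwarz inequality. -/

section Gowers

variable {G : Type*} [AddCommGroup G] [Fintype G]

/-- The multiplicative derivative `x ↦ f x * conj (f (x + h))`. -/
def multDeriv (h : G) (f : G → ℂ) : G → ℂ := fun x => f x * starRingEnd ℂ (f (x + h))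

/-- The average whose `2 ^ d`-th root is the Gowers norm, defined recursively through
multiplicative derivatives. -/
def gowersAverage : ℕ → (G → ℂ) → ℂ
  | 0, f => 𝔼 x, f x
  | d + 1, f => 𝔼 h, gowersAverage d (multDeriv h f)

lemma prod_finset_fin_succ {d : ℕ} (F : Finset (Fin (d + 1)) → ℂ) :
    ∏ ω, F ω = ∏ ω : Finset (Fin d), F (ω.map (Fin.succEmb d)) *
      F (Finset.cons 0 (ω.map (Fin.succEmb d)) (by simp [Fin.succ_ne_zero])) := by
  have h1 : (Finset.univ : Finset (Finset (Fin (d + 1)))) =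
      (Finset.cons 0 (Finset.univ.map (Fin.succEmb d)) (by simp [Fin.succ_ne_zero])).powerset := by
    rw [← Finset.powerset_univ, Fin.univ_succ]
    congr 1
  have h2 : (Finset.univ.map (Fin.succEmb d)).powerset =
      (Finset.univ : Finset (Finset (Fin d))).map
        ⟨fun ω => ω.map (Fin.succEmb d), Finset.map_injective _⟩ := by
    ext s
    simp only [Finset.mem_powerset, Finset.mem_map, Finset.mem_univ, true_and,
      Function.Embedding.coeFn_mk, Finset.subset_map_iff]
    simp [eq_comm]
  rw [h1, Finset.cons_eq_insert, Finset.prod_powerset_insert (by simp [Fin.succ_ne_zero]), h2,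
    Finset.prod_map, Finset.prod_map, ← Finset.prod_mul_distrib]
  simp [Finset.cons_eq_insert]

lemma conj_iterate_mul (m : ℕ) (a b : ℂ) :
    (starRingEnd ℂ)^[m] (a * b) = (starRingEnd ℂ)^[m] a * (starRingEnd ℂ)^[m] b :=
  iterate_map_mul _ _ _ _

lemma gowersAverage_eq (d : ℕ) (f : G → ℂ) :
    gowersAverage d f = 𝔼 x : G, 𝔼 h : Fin d → G,
      ∏ ω : Finset (Fin d), (starRingEnd ℂ)^[ω.card] (f (x + ∑ i ∈ ω, h i)) := by
  induction d generalizing f with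
  | zero =>
    have : (default : Finset (Fin 0)) = ∅ := Subsingleton.elim _ _
    simp [gowersAverage, this]
  | succ d ih =>
    simp only [gowersAverage, ih, expect_fin_cons (d := d)]
    rw [Finset.expect_comm]
    refine Finset.expect_congr rfl fun x _ => Finset.expect_congr rfl fun u _ =>
      Finset.expect_congr rfl fun w _ => ?_
    rw [prod_finset_fin_succ]
    refine Finset.prod_congr rfl fun ω _ => ?_
    simp only [multDeriv, conj_iterate_mul, Finset.card_map, Finset.sum_map, Fin.coe_succEmb,
      Fin.cons_succ, Finset.card_cons, Finset.sum_cons, Fin.cons_zero,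
      Function.iterate_succ_apply]
    congr 3
    abel_nf

lemma gowersNorm_eq (d : ℕ) (f : G → ℂ) :
    gowersNorm d f = ‖gowersAverage d f‖ ^ ((1 : ℝ) / 2 ^ d) := by
  rw [gowersNorm, gowersAverage_eq]

lemma gowersNorm_nonneg (d : ℕ) (f : G → ℂ) : 0 ≤ gowersNorm d f := by
  rw [gowersNorm_eq]; positivity

lemma gowersNorm_pow (d : ℕ) (f : G → ℂ) : gowersNorm d f ^ 2 ^ d = ‖gowersAverage d f‖ := by
  rw [gowersNorm_eq, ← Real.rpow_natCast, ← Real.rpow_mul (norm_nonneg _)]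
  simp

lemma OneBounded.mul_conj {X : Type*} {f g : X → ℂ} (hf : OneBounded f) (hg : OneBounded g) :
    OneBounded fun x => f x * starRingEnd ℂ (g x) := fun x => by
  rw [norm_mul, RCLike.norm_conj]
  exact mul_le_one₀ (hf x) (norm_nonneg _) (hg x)

lemma norm_gowersAverage_le_one {f : G → ℂ} (hf : OneBounded f) (d : ℕ) :
    ‖gowersAverage d f‖ ≤ 1 := by
  induction d generalizing f with
  | zero => exact norm_expect_le_one hf
  | succ d ih => exact norm_expect_le_one fun h => ih (hf.mul_conj fun x => hf (x + h))

lemma gowersNorm_le_one {f : G → ℂ} (hf : OneBounded f) (d : ℕ) : gowersNorm d f ≤ 1 := by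
  rw [gowersNorm_eq]
  exact Real.rpow_le_one (norm_nonneg _) (norm_gowersAverage_le_one hf d) (by positivity)

lemma gowersAverage_succ_eq_norm (d : ℕ) (f : G → ℂ) :
    gowersAverage (d + 1) f = (‖gowersAverage (d + 1) f‖ : ℂ) := by
  suffices h : ∃ r : ℝ, 0 ≤ r ∧ gowersAverage (d + 1) f = r by
    obtain ⟨r, hr, h⟩ := h
    rw [h, Complex.norm_real, Real.norm_of_nonneg hr]
  induction d generalizing f with
  | zero =>
    refine ⟨‖𝔼 x, f x‖ ^ 2, by positivity, ?_⟩
    simp only [gowersAverage, multDeriv]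
    rw [Finset.expect_comm]
    simp_rw [← Finset.mul_expect]
    have : ∀ x, 𝔼 h, starRingEnd ℂ (f (x + h)) = starRingEnd ℂ (𝔼 h, f h) := fun x => by
      rw [map_expect, ← expect_add_right_eq (fun h => starRingEnd ℂ (f h)) x]
      simp_rw [add_comm x]
    simp_rw [this]
    rw [← Finset.expect_mul, Complex.mul_conj, Complex.normSq_eq_norm_sq]
  | succ d ih =>
    choose r hr h using fun u => ih (multDeriv u f)
    refine ⟨𝔼 u, r u, Finset.expect_nonneg fun u _ => hr u, ?_⟩
    rw [gowersAverage]
    simp_rw [h]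
    simp

/-- A factor that only depends on `y + v i` and on the coordinates of `v` other than `v i`. -/
def ShearInvariant {d : ℕ} (i : Fin d) (C : G → (Fin d → G) → ℂ) : Prop :=
  ∀ a y v, C (y + a) (v - Pi.single i a) = C y v

/-- With `s = y + v 0`, the factor `C 0` depends only on `s` and the other coordinates, so
Cauchy–Schwarz removes it. Expanding the square over pairs `u`, `u - h` differentiates `g` and keeps
the other shear invariances. -/
lemma norm_expect_mul_prod_sq_le {d : ℕ} (g : G → ℂ) (C : Fin (d + 1) → G → (Fin (d + 1) → G) → ℂ)
    (hC : ∀ i y v, ‖C i y v‖ ≤ 1) (hinv : ∀ i, ShearInvariant i (C i)) :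
    ‖𝔼 y, 𝔼 v, g y * ∏ i, C i y v‖ ^ 2 ≤
      ‖𝔼 h, 𝔼 u, 𝔼 y, 𝔼 w : Fin d → G, multDeriv h g y * ∏ i : Fin d,
        (C i.succ y (Fin.cons u w) *
          starRingEnd ℂ (C i.succ (y + h) (Fin.cons (u - h) w)))‖ := by
  set B : G → G → (Fin d → G) → ℂ := fun y u w => g y * ∏ i : Fin d, C i.succ y (Fin.cons u w)
    with hB
  have h1 : 𝔼 y, 𝔼 v, g y * ∏ i, C i y v =
      𝔼 q : G × (Fin d → G), C 0 q.1 (Fin.cons 0 q.2) * 𝔼 u, B (q.1 - u) u q.2 := by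
    rw [← Finset.univ_product_univ, Finset.expect_product]
    simp_rw [expect_fin_cons (d := d), Finset.mul_expect]
    rw [Finset.expect_comm]
    simp_rw [Finset.expect_comm (s := (Finset.univ : Finset (Fin d → G)))
      (t := (Finset.univ : Finset G))]
    rw [Finset.expect_comm (s := (Finset.univ : Finset G)) (t := (Finset.univ : Finset G))
      (f := fun s u => 𝔼 w, C 0 s (Fin.cons 0 w) * B (s - u) u w)]
    refine Finset.expect_congr rfl fun u _ => ?_
    rw [← expect_add_right_eq _ (-u)]
    refine Finset.expect_congr rfl fun s _ => Finset.expect_congr rfl fun w _ => ?_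
    have : C 0 (s + -u) (Fin.cons u w) = C 0 s (Fin.cons 0 w) := by
      rw [← hinv 0 u]
      congr 1
      · abel
      · funext j
        refine Fin.cases ?_ (fun j => ?_) j <;> simp
    rw [Fin.prod_univ_succ, this, hB, ← sub_eq_add_neg]
    ring
  have h2 : ((𝔼 q : G × (Fin d → G), ‖𝔼 u, B (q.1 - u) u q.2‖ ^ 2 : ℝ) : ℂ) =
      𝔼 h, 𝔼 u, 𝔼 y, 𝔼 w : Fin d → G, B y u w * starRingEnd ℂ (B (y + h) (u - h) w) := by
    have h3 : ∀ q : G × (Fin d → G), ((‖𝔼 u, B (q.1 - u) u q.2‖ ^ 2 : ℝ) : ℂ) =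
        𝔼 h, 𝔼 u, B (q.1 - u) u q.2 * starRingEnd ℂ (B (q.1 - u + h) (u - h) q.2) := by
      intro q
      rw [← Complex.normSq_eq_norm_sq, ← Complex.mul_conj, map_expect, Finset.expect_mul_expect,
        Finset.expect_comm]
      rw [Finset.expect_comm]
      conv_rhs => rw [Finset.expect_comm]
      refine Finset.expect_congr rfl fun u _ => ?_
      rw [← expect_sub_left_eq _ u]
      refine Finset.expect_congr rfl fun h _ => ?_
      rw [sub_add]
    rw [Complex.ofReal_expect]
    simp_rw [h3]
    rw [Finset.expect_comm]
    refine Finset.expect_congr rfl fun h _ => ?_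
    rw [Finset.expect_comm]
    refine Finset.expect_congr rfl fun u _ => ?_
    rw [← Finset.univ_product_univ, Finset.expect_product, ← expect_add_right_eq _ u]
    simp
  have h4 : 𝔼 h, 𝔼 u, 𝔼 y, 𝔼 w : Fin d → G, multDeriv h g y * ∏ i : Fin d,
        (C i.succ y (Fin.cons u w) *
          starRingEnd ℂ (C i.succ (y + h) (Fin.cons (u - h) w))) =
      𝔼 h, 𝔼 u, 𝔼 y, 𝔼 w : Fin d → G, B y u w * starRingEnd ℂ (B (y + h) (u - h) w) := by
    refine Finset.expect_congr rfl fun h _ => Finset.expect_congr rfl fun u _ =>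
      Finset.expect_congr rfl fun y _ => Finset.expect_congr rfl fun w _ => ?_
    simp only [hB, multDeriv, map_mul, map_prod, Finset.prod_mul_distrib]
    ring
  rw [h1, h4, ← h2, Complex.norm_real]
  exact (norm_expect_mul_sq_le _ fun q => hC _ _ _).trans (le_abs_self _)

lemma norm_expect_mul_prod_pow_le {d : ℕ} (g : G → ℂ) (C : Fin d → G → (Fin d → G) → ℂ)
    (hC : ∀ i y v, ‖C i y v‖ ≤ 1) (hinv : ∀ i, ShearInvariant i (C i)) :
    ‖𝔼 y, 𝔼 v, g y * ∏ i, C i y v‖ ^ 2 ^ d ≤ ‖gowersAverage d g‖ := by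
  -- Order 0 is split off: the induction needs the averages of the derivatives to be nonnegative
  -- reals, which holds only from order 1 on.
  rcases d with _ | d
  · simp [gowersAverage]
  induction d generalizing g with
  | zero =>
    refine le_of_eq_of_le (by norm_num) ((norm_expect_mul_prod_sq_le g C hC hinv).trans ?_)
    simp [gowersAverage]
  | succ d ih =>
    have hn : ∀ h u, ‖𝔼 y, 𝔼 w : Fin (d + 1) → G, multDeriv h g y * ∏ i : Fin (d + 1),
        (C i.succ y (Fin.cons u w) *
          starRingEnd ℂ (C i.succ (y + h) (Fin.cons (u - h) w)))‖ ^ 2 ^ (d + 1) ≤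
        ‖gowersAverage (d + 1) (multDeriv h g)‖ := by
      intro h u
      refine ih (multDeriv h g) (fun i y w => C i.succ y (Fin.cons u w) *
          starRingEnd ℂ (C i.succ (y + h) (Fin.cons (u - h) w))) (fun i y w => ?_)
        fun i a y w => ?_
      · rw [norm_mul, RCLike.norm_conj]
        exact mul_le_one₀ (hC _ _ _) (norm_nonneg _) (hC _ _ _)
      · have hc : ∀ b : G, (Fin.cons b (w - Pi.single i a) : Fin (d + 2) → G) =
            Fin.cons b w - Pi.single i.succ a := by
          intro b
          funext j
          refine Fin.cases ?_ (fun j => ?_) j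
          · simp [(Fin.succ_ne_zero i).symm]
          · simp [Pi.single_apply]
        simp only [hc, add_right_comm y a h, hinv i.succ a]
    have hg : 𝔼 h : G, ‖gowersAverage (d + 1) (multDeriv h g)‖ = ‖gowersAverage (d + 2) g‖ := by
      have : gowersAverage (d + 2) g =
          ((𝔼 h : G, ‖gowersAverage (d + 1) (multDeriv h g)‖ : ℝ) : ℂ) := by
        rw [gowersAverage, Complex.ofReal_expect]
        exact Finset.expect_congr rfl fun h _ => gowersAverage_succ_eq_norm _ _
      rw [this, Complex.norm_real,
        Real.norm_of_nonneg (Finset.expect_nonneg fun _ _ => norm_nonneg _)]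
    rw [pow_succ', pow_mul]
    refine (pow_le_pow_left₀ (by positivity) (norm_expect_mul_prod_sq_le g C hC hinv) _).trans ?_
    rw [← hg]
    refine (pow_le_pow_left₀ (norm_nonneg _) (RCLike.norm_expect_le (K := ℂ)) _).trans ?_
    refine (expect_pow_two_pow_le _ (fun _ => norm_nonneg _) _).trans
      (Finset.expect_le_expect fun h _ => ?_)
    refine (pow_le_pow_left₀ (norm_nonneg _) (RCLike.norm_expect_le (K := ℂ)) _).trans ?_
    refine (expect_pow_two_pow_le _ (fun _ => norm_nonneg _) _).trans
      (Finset.expect_le Finset.univ_nonempty fun u _ => hn h u)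

/-- The Gowers–Cauchy–Schwarz inequality. -/
theorem norm_expect_mul_prod_le_gowersNorm {d : ℕ} (g : G → ℂ) (C : Fin d → G → (Fin d → G) → ℂ)
    (hC : ∀ i y v, ‖C i y v‖ ≤ 1) (hinv : ∀ i, ShearInvariant i (C i)) :
    ‖𝔼 y, 𝔼 v, g y * ∏ i, C i y v‖ ≤ gowersNorm d g := by
  refine le_of_pow_le_pow_left₀ (n := 2 ^ d) (by positivity) (gowersNorm_nonneg d g) ?_
  rw [gowersNorm_pow]
  exact norm_expect_mul_prod_pow_le g C hC hinv

end Gowers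

/-! ### Structured functions and convex hulls of shear products. -/

lemma Convex.expect_mem {E ι : Type*} [AddCommGroup E] [Module ℝ E] [Module ℚ≥0 E] [Fintype ι]
    [Nonempty ι] {s : Set E} (hs : Convex ℝ s) {f : ι → E} (hf : ∀ i, f i ∈ s) :
    𝔼 i, f i ∈ s := by
  have hn : (Fintype.card ι : ℝ) ≠ 0 := by simp
  have h : 𝔼 i, f i = ∑ i, (Fintype.card ι : ℝ)⁻¹ • f i := by
    rw [← Finset.smul_sum, eq_inv_smul_iff₀ hn, Nat.cast_smul_eq_nsmul,
      Fintype.card_smul_expect]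
  rw [h]
  exact hs.sum_mem (fun i _ => by positivity) (by simp) fun i _ => hf i

lemma apply_mem_of_mem_convexHull {E F : Type*} [AddCommGroup E] [Module ℝ E] [AddCommGroup F]
    [Module ℝ F] {L : E → F} (hL : IsLinearMap ℝ L) {S : Set E} {T : Set F} (hT : Convex ℝ T)
    (h : ∀ A ∈ S, L A ∈ T) {Q : E} (hQ : Q ∈ convexHull ℝ S) : L Q ∈ T :=
  convexHull_min (t := L ⁻¹' T) h (hT.is_linear_preimage hL) hQ

section Structured

variable {G : Type*} [AddCommGroup G] {d : ℕ}

/-- Products of `d` bounded functions of `(y, v)`, the `i`-th of which depends only on `y + v i` and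
on the coordinates of `v` other than `v i`. -/
def shearProducts (G : Type*) [AddCommGroup G] (d : ℕ) : Set (G → (Fin d → G) → ℂ) :=
  {Q | ∃ C : Fin d → G → (Fin d → G) → ℂ, (∀ i y v, ‖C i y v‖ ≤ 1) ∧
    (∀ i, ShearInvariant i (C i)) ∧ Q = fun y v => ∏ i, C i y v}

lemma one_mem_shearProducts : (1 : G → (Fin d → G) → ℂ) ∈ shearProducts G d :=
  ⟨fun _ _ _ => 1, by simp, fun i a y v => rfl, by ext; simp⟩

lemma mul_mem_shearProducts {Q R : G → (Fin d → G) → ℂ} (hQ : Q ∈ shearProducts G d)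
    (hR : R ∈ shearProducts G d) : Q * R ∈ shearProducts G d := by
  obtain ⟨C, hC, hCi, rfl⟩ := hQ
  obtain ⟨D, hD, hDi, rfl⟩ := hR
  refine ⟨fun i y v => C i y v * D i y v, fun i y v => ?_, fun i a y v => ?_, ?_⟩
  · rw [norm_mul]
    exact mul_le_one₀ (hC _ _ _) (norm_nonneg _) (hD _ _ _)
  · simp only [hCi i a, hDi i a]
  · ext y v
    simp [Finset.prod_mul_distrib]

lemma mul_mem_convexHull_shearProducts {Q R : G → (Fin d → G) → ℂ}
    (hQ : Q ∈ convexHull ℝ (shearProducts G d)) (hR : R ∈ convexHull ℝ (shearProducts G d)) :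
    Q * R ∈ convexHull ℝ (shearProducts G d) := by
  refine apply_mem_of_mem_convexHull (L := fun Q => Q * R)
    ⟨fun x y => add_mul _ _ _, fun c x => smul_mul_assoc _ _ _⟩ (convex_convexHull ℝ _)
    (fun A hA => ?_) hQ
  exact apply_mem_of_mem_convexHull (L := fun R => A * R)
    ⟨fun x y => mul_add _ _ _, fun c x => mul_smul_comm _ _ _⟩ (convex_convexHull ℝ _)
    (fun B hB => subset_convexHull ℝ _ (mul_mem_shearProducts hA hB)) hR

lemma prod_mem_convexHull_shearProducts {ι : Type*} (s : Finset ι) {Q : ι → G → (Fin d → G) → ℂ}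
    (hQ : ∀ i ∈ s, Q i ∈ convexHull ℝ (shearProducts G d)) :
    ∏ i ∈ s, Q i ∈ convexHull ℝ (shearProducts G d) :=
  Finset.prod_induction Q (· ∈ convexHull ℝ (shearProducts G d))
    (fun _ _ => mul_mem_convexHull_shearProducts)
    (subset_convexHull ℝ _ one_mem_shearProducts) hQ

lemma norm_le_one_of_mem_convexHull_shearProducts {Q : G → (Fin d → G) → ℂ}
    (hQ : Q ∈ convexHull ℝ (shearProducts G d)) (y : G) (v : Fin d → G) : ‖Q y v‖ ≤ 1 := by
  have := apply_mem_of_mem_convexHull (L := fun Q : G → (Fin d → G) → ℂ => Q y v)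
    ⟨fun _ _ => rfl, fun _ _ => rfl⟩ (convex_closedBall (0 : ℂ) 1) (fun A hA => ?_) hQ
  · simpa using this
  · obtain ⟨C, hC, -, rfl⟩ := hA
    simpa using
      Finset.prod_le_one (s := Finset.univ) (fun i _ => norm_nonneg _) fun i _ => hC i y v

lemma conj_mem_convexHull_shearProducts {Q : G → (Fin d → G) → ℂ}
    (hQ : Q ∈ convexHull ℝ (shearProducts G d)) :
    (fun y v => starRingEnd ℂ (Q y v)) ∈ convexHull ℝ (shearProducts G d) := by
  refine apply_mem_of_mem_convexHull
    (L := fun (Q : G → (Fin d → G) → ℂ) y v => starRingEnd ℂ (Q y v))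
    ⟨fun _ _ => by ext; simp, fun _ _ => by ext; simp⟩ (convex_convexHull ℝ _)
    (fun A hA => subset_convexHull ℝ _ ?_) hQ
  obtain ⟨C, hC, hCi, rfl⟩ := hA
  exact ⟨fun i y v => starRingEnd ℂ (C i y v), by simpa using hC,
    fun i a y v => by simp only [hCi i a], by simp⟩

variable {K : Type*} [CommRing K] [Module K G]

lemma comp_mem_shearProducts_of_eq_one {f : G → ℂ} (hf : OneBounded f) (r : G) {μ : Fin d → K}
    {i : Fin d} (hi : μ i = 1) :
    (fun y v => f (y + r + ∑ j, μ j • v j)) ∈ shearProducts G d := by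
  refine ⟨fun k y v => if k = i then f (y + r + ∑ j, μ j • v j) else 1, fun k y v => ?_,
    fun k a y v => ?_, ?_⟩
  · dsimp only
    split_ifs
    · exact hf _
    · simp
  · dsimp only
    split_ifs with h
    · subst h
      congr 1
      simp [smul_sub, Finset.sum_sub_distrib, Pi.single_apply, hi]
      abel
    · rfl
  · ext y v
    simp

/-- The second argument is chosen so that the shear by `a` in direction `i` acts on the arguments of
`Q` as the shear by `(1 - μ i) • a`. No condition on `μ` is needed. -/
lemma comp_mem_convexHull_shearProducts {Q : G → (Fin d → G) → ℂ}
    (hQ : Q ∈ convexHull ℝ (shearProducts G d)) (r : G) (h : Fin d → G) (μ : Fin d → K) :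
    (fun y v => Q (y + r + ∑ j, μ j • v j) (h + fun j => (1 - μ j) • v j)) ∈
      convexHull ℝ (shearProducts G d) := by
  refine apply_mem_of_mem_convexHull
    (L := fun (Q : G → (Fin d → G) → ℂ) (y : G) (v : Fin d → G) =>
      Q (y + r + ∑ j, μ j • v j) (h + fun j => (1 - μ j) • v j))
    ⟨fun _ _ => rfl, fun _ _ => rfl⟩ (convex_convexHull ℝ _)
    (fun A hA => subset_convexHull ℝ _ ?_) hQ
  obtain ⟨C, hC, hCi, rfl⟩ := hA
  refine ⟨fun i y v => C i (y + r + ∑ j, μ j • v j) (h + fun j => (1 - μ j) • v j),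
    fun i y v => hC _ _ _, fun i a y v => ?_, rfl⟩
  dsimp only
  rw [← hCi i ((1 - μ i) • a) (y + r + ∑ j, μ j • v j)]
  congr 1
  · simp [smul_sub, Finset.sum_sub_distrib, Pi.single_apply, sub_smul]
    abel
  · funext j
    by_cases hj : j = i
    · subst hj
      simp [smul_sub]
      abel
    · simp [hj]

variable [Fintype G]

/-- A function is structured of order `d` if it is `y ↦ 𝔼 v, Q y v` for a convex combination `Q` of
`shearProducts`. -/
def Structured (d : ℕ) (F : G → ℂ) : Prop :=
  ∃ Q ∈ convexHull ℝ (shearProducts G d), F = fun y => 𝔼 v, Q y v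

lemma comp_mem_convexHull_of_structured {F : G → ℂ} (hF : Structured d F) (r : G)
    (μ : Fin d → K) :
    (fun y v => F (y + r + ∑ j, μ j • v j)) ∈ convexHull ℝ (shearProducts G d) := by
  obtain ⟨Q, hQ, rfl⟩ := hF
  -- For fixed `y` and `v`, the averaging variable may be translated by `(1 - μ j) • v j`; each
  -- fixed `h` then gives a member of the hull.
  have h : (fun (y : G) (v : Fin d → G) => 𝔼 h, Q (y + r + ∑ j, μ j • v j) h) =
      𝔼 h : Fin d → G,
        fun y v => Q (y + r + ∑ j, μ j • v j) (h + fun j => (1 - μ j) • v j) := by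
    ext y v
    rw [Finset.expect_apply, Finset.expect_apply]
    exact (expect_add_right_eq _ _).symm
  simp only [h]
  exact (convex_convexHull ℝ _).expect_mem fun h => comp_mem_convexHull_shearProducts hQ r h μ

lemma Structured.oneBounded {F : G → ℂ} (hF : Structured d F) : OneBounded F := by
  obtain ⟨Q, hQ, rfl⟩ := hF
  exact fun y => norm_expect_le_one fun v => norm_le_one_of_mem_convexHull_shearProducts hQ y v

lemma Structured.conj {F : G → ℂ} (hF : Structured d F) :
    Structured d fun y => starRingEnd ℂ (F y) := by
  obtain ⟨Q, hQ, rfl⟩ := hF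
  exact ⟨_, conj_mem_convexHull_shearProducts hQ, by ext y; simp [map_expect]⟩

/-- Structured functions of order `d` have `U^d`-dual norm at most one. -/
theorem Structured.norm_expect_mul_le {F : G → ℂ} (hF : Structured d F) (g : G → ℂ) :
    ‖𝔼 y, g y * F y‖ ≤ gowersNorm d g := by
  obtain ⟨Q, hQ, rfl⟩ := hF
  simp_rw [Finset.mul_expect]
  have := apply_mem_of_mem_convexHull
    (L := fun Q : G → (Fin d → G) → ℂ => 𝔼 y, 𝔼 v, g y * Q y v)
    ⟨fun _ _ => by simp [mul_add, Finset.expect_add_distrib],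
      fun c Q => by simp [Finset.smul_expect, mul_left_comm]⟩
    (convex_closedBall (0 : ℂ) (gowersNorm d g)) (fun A hA => ?_) hQ
  · simpa using this
  · obtain ⟨C, hC, hCi, rfl⟩ := hA
    simpa using norm_expect_mul_prod_le_gowersNorm g C hC hCi

end Structured

/-! ### Dual functions and iterated Cauchy–Schwarz. -/

section Dual

variable {G : Type*} [AddCommGroup G] [Fintype G] {K : Type*} [CommRing K] [Module K G]
  {ι : Type*} [Fintype ι] [DecidableEq ι] {M d : ℕ}

/-- The dual function at the point `P z` of the average over affine images of the configuration
`P`. -/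
def dualFunction (P : ι → Fin M → K) (f : ι → G → ℂ) (z : ι) (y : G) : ℂ :=
  𝔼 t : Fin M → G, ∏ w ∈ Finset.univ.erase z, f w (y + ∑ j, (P w j - P z j) • t j)

theorem structured_dualFunction (P : ι → Fin M → K) (f : ι → G → ℂ) (z : ι) (ℓ : Fin d → Fin M → K)
    (h : ∀ w ≠ z, Structured d (f w) ∨
      OneBounded (f w) ∧ ∃ i, ∑ j, ℓ i j * (P w j - P z j) = 1) :
    Structured d (dualFunction P f z) := by
  set μ : ι → Fin d → K := fun w i => ∑ j, ℓ i j * (P w j - P z j) with hμ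
  refine ⟨𝔼 t : Fin M → G, ∏ w ∈ Finset.univ.erase z,
    (fun y v => f w (y + (∑ j, (P w j - P z j) • t j) + ∑ i, μ w i • v i) :
      G → (Fin d → G) → ℂ), ?_, ?_⟩
  · refine (convex_convexHull ℝ _).expect_mem fun t =>
      prod_mem_convexHull_shearProducts (Finset.univ.erase z) fun w hw => ?_
    rcases h w (Finset.ne_of_mem_erase hw) with h | ⟨h, i, hi⟩
    · exact comp_mem_convexHull_of_structured h _ _
    · exact subset_convexHull ℝ _ (comp_mem_shearProducts_of_eq_one h _ hi)
  · ext y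
    simp only [Finset.expect_apply, Finset.prod_apply]
    rw [← Fintype.expect_const (ι := Fin d → G) (dualFunction P f z y)]
    refine Finset.expect_congr rfl fun v _ => ?_
    -- Translating `t` by `∑ i, ℓ i • v i` adds `∑ i, μ w i • v i` to the argument of `f w`.
    rw [dualFunction, ← expect_add_right_eq _ (fun j => ∑ i, ℓ i j • v i : Fin M → G)]
    refine Finset.expect_congr rfl fun t _ => Finset.prod_congr rfl fun w _ => ?_
    rw [add_assoc]
    congr 2
    simp only [hμ, Pi.add_apply, smul_add, Finset.sum_add_distrib, Finset.smul_sum, Finset.sum_smul,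
      smul_smul]
    rw [Finset.sum_comm (s := (Finset.univ : Finset (Fin M)))]
    simp_rw [mul_comm]

end Dual

section System

variable {p : ℕ} [Fact p.Prime] {ι : Type*} [Fintype ι] [DecidableEq ι] {M d n : ℕ}

lemma systemAverage_eq_expect_dualFunction (P : ι → Fin M → ZMod p)
    (f : ι → (Fin n → ZMod p) → ℂ) (z : ι) :
    systemAverage (fun w => Fin.cons 1 (P w) : ι → Fin (M + 1) → ZMod p) f =
      𝔼 y, f z y * dualFunction P f z y := by
  simp_rw [systemAverage, expect_fin_cons, dualFunction, Finset.mul_expect]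
  rw [Finset.expect_comm]
  conv_rhs => rw [Finset.expect_comm]
  refine Finset.expect_congr rfl fun t _ => ?_
  rw [← expect_add_right_eq _ (-∑ j, P z j • t j)]
  refine Finset.expect_congr rfl fun y _ => ?_
  rw [← Finset.mul_prod_erase Finset.univ _ (Finset.mem_univ z)]
  simp only [Fin.sum_univ_succ, Fin.cons_zero, Fin.cons_succ, one_smul, sub_smul,
    Finset.sum_sub_distrib]
  congr 1
  · congr 1
    abel
  · refine Finset.prod_congr rfl fun w _ => ?_
    congr 1
    abel

lemma norm_systemAverage_le_of_structured (P : ι → Fin M → ZMod p)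
    (f : ι → (Fin n → ZMod p) → ℂ) (z : ι) (hD : Structured d (dualFunction P f z)) :
    ‖systemAverage (fun w => Fin.cons 1 (P w) : ι → Fin (M + 1) → ZMod p) f‖ ≤
      gowersNorm d (f z) := by
  rw [systemAverage_eq_expect_dualFunction P f z]
  exact hD.norm_expect_mul_le _

/-- Cauchy–Schwarz leaves the mean square of the dual function at `z`, which is again an average
over the system because that dual function does not involve `f z`. -/
lemma norm_systemAverage_sq_le (P : ι → Fin M → ZMod p) (f : ι → (Fin n → ZMod p) → ℂ) (z : ι)
    (hz : OneBounded (f z)) :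
    ‖systemAverage (fun w => Fin.cons 1 (P w) : ι → Fin (M + 1) → ZMod p) f‖ ^ 2 ≤
      ‖systemAverage (fun w => Fin.cons 1 (P w) : ι → Fin (M + 1) → ZMod p)
        (Function.update f z fun y => starRingEnd ℂ (dualFunction P f z y))‖ := by
  rw [systemAverage_eq_expect_dualFunction P f z, systemAverage_eq_expect_dualFunction P _ z]
  refine (norm_expect_mul_sq_le _ hz).trans (le_of_eq ?_)
  have h : dualFunction P (Function.update f z fun y => starRingEnd ℂ (dualFunction P f z y)) z =
      dualFunction P f z := by
    ext y
    refine Finset.expect_congr rfl fun t _ => Finset.prod_congr rfl fun w hw => ?_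
    rw [Function.update_of_ne (Finset.ne_of_mem_erase hw)]
  rw [h, Function.update_self]
  simp_rw [mul_comm, Complex.mul_conj, Complex.normSq_eq_norm_sq]
  rw [← Complex.ofReal_expect, Complex.norm_real,
    Real.norm_of_nonneg (Finset.expect_nonneg fun _ _ => by positivity)]

/-- Suppose that the points of the configuration `P` carry weights such that every point `z` has `d`
affine hyperplanes missing `P z` which cover all other points of weight at most that of `z`. Then
replacing functions by dual functions, heaviest points first, bounds the average by a power of a
Gowers norm. -/
theorem norm_systemAverage_le_of_cover (P : ι → Fin M → ZMod p) (wt : ι → ℕ)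
    (hcover : ∀ z, ∃ ℓ : Fin d → Fin M → ZMod p, ∀ w ≠ z, wt w ≤ wt z →
      ∃ i, ∑ j, ℓ i j * (P w j - P z j) = 1)
    (s : Finset ι) (f : ι → (Fin n → ZMod p) → ℂ) (hf : ∀ w, OneBounded (f w))
    (hs : ∀ w ∉ s, Structured d (f w)) (z : ι) (hz : z ∈ s) :
    ‖systemAverage (fun w => Fin.cons 1 (P w) : ι → Fin (M + 1) → ZMod p) f‖ ^ 2 ^ (s.card - 1) ≤
      gowersNorm d (f z) := by
  induction hm : s.card generalizing s f with
  | zero => simp [Finset.card_eq_zero.mp hm] at hz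
  | succ m ih =>
    obtain ⟨u, hu, hmax⟩ := s.exists_max_image wt ⟨z, hz⟩
    have hD : Structured d (dualFunction P f u) := by
      obtain ⟨ℓ, hℓ⟩ := hcover u
      refine structured_dualFunction P f u ℓ fun w hw => ?_
      by_cases hws : w ∈ s
      · exact Or.inr ⟨hf w, hℓ w hw (hmax w hws)⟩
      · exact Or.inl (hs w hws)
    -- At `u = z` the dual bound finishes, and surplus powers are harmless as the average is at most
    -- 1. Otherwise `f u` is replaced at the cost of one square.
    by_cases huz : u = z
    · subst huz
      have hle := norm_systemAverage_le_of_structured P f u hD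
      refine le_trans ?_ hle
      refine pow_le_of_le_one (norm_nonneg _) ?_ (by positivity)
      exact hle.trans (gowersNorm_le_one (hf u) d)
    · have hzu : z ∈ s.erase u := Finset.mem_erase.mpr ⟨Ne.symm huz, hz⟩
      have hcard : (s.erase u).card = m := by rw [Finset.card_erase_of_mem hu, hm]; rfl
      have hm0 : 0 < m := hcard ▸ Finset.card_pos.mpr ⟨z, hzu⟩
      have key := ih (s.erase u)
        (Function.update f u fun y => starRingEnd ℂ (dualFunction P f u y)) (fun w => ?_)
        (fun w hw => ?_) hzu hcard
      · rw [Function.update_of_ne (Ne.symm huz)] at key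
        refine le_trans ?_ key
        obtain ⟨m, rfl⟩ := Nat.exists_eq_add_of_lt hm0
        rw [show 0 + m + 1 + 1 - 1 = m + 1 by omega, show 0 + m + 1 - 1 = m by omega, pow_succ',
          pow_mul]
        exact pow_le_pow_left₀ (by positivity) (norm_systemAverage_sq_le P f u (hf u)) _
      · by_cases hwu : w = u
        · subst hwu
          simpa using hD.conj.oneBounded
        · simpa [hwu] using hf w
      · by_cases hwu : w = u
        · subst hwu
          simpa using hD.conj
        · simpa [hwu] using hs w fun h => hw (Finset.mem_erase.mpr ⟨hwu, h⟩)

end System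

/-! ### Covering points by affine hyperplanes. -/

section Cover

variable {p : ℕ} [Fact p.Prime] {M d : ℕ}

lemma exists_fin_family {κ α : Type*} [Fintype κ] [Inhabited α] (F : κ → α)
    (h : Fintype.card κ ≤ d) : ∃ ℓ : Fin d → α, ∀ k, ∃ i, ℓ i = F k := by
  obtain ⟨e⟩ : Nonempty (κ ↪ Fin d) := Function.Embedding.nonempty_of_card_le (by simpa using h)
  exact ⟨Function.extend e F default, fun k => ⟨e k, e.injective.extend_apply F default k⟩⟩

lemma natCast_zmod_sub_ne_zero {a b : ℕ} (hab : a ≠ b) (ha : a < p) (hb : b < p) :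
    (a : ZMod p) - b ≠ 0 := by
  rw [sub_ne_zero, Ne, ZMod.natCast_eq_natCast_iff', Nat.mod_eq_of_lt ha, Nat.mod_eq_of_lt hb]
  exact hab

/-- The hyperplanes `{w j = i}` for `i < z j`, together with the hyperplanes on which the sum of
coordinates is `1, …, m` larger than at `z`, cover all points other than `z` whose weight is at most
`m` more than the weight of `z`. -/
lemma exists_hyperplane_cover (z : Fin M → Fin p) (m : ℕ) (hm : m < p)
    (hd : ∑ j, (z j : ℕ) + m ≤ d) :
    ∃ ℓ : Fin d → Fin M → ZMod p, ∀ w : Fin M → Fin p, w ≠ z →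
      ∑ j, (w j : ℕ) ≤ ∑ j, (z j : ℕ) + m →
        ∃ i, ∑ j, ℓ i j * (((w j : ℕ) : ZMod p) - ((z j : ℕ) : ZMod p)) = 1 := by
  -- The inverses normalise each form to equal 1 at `w - z` on its hyperplane; `i + 1` is invertible
  -- because `m < p`.
  let F : (Σ j, Fin (z j : ℕ)) ⊕ Fin m → Fin M → ZMod p :=
    Sum.elim (fun q => Pi.single q.1 (((q.2 : ℕ) : ZMod p) - ((z q.1 : ℕ) : ZMod p))⁻¹)
      fun i _ => (((i + 1 : ℕ) : ZMod p))⁻¹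
  obtain ⟨ℓ, hℓ⟩ := exists_fin_family (d := d) F (by simpa using hd)
  refine ⟨ℓ, fun w hw hwt => ?_⟩
  by_cases hlt : ∃ j, w j < z j
  · obtain ⟨j, hj⟩ := hlt
    obtain ⟨i, hi⟩ := hℓ (Sum.inl ⟨j, ⟨w j, hj⟩⟩)
    refine ⟨i, ?_⟩
    rw [hi, Finset.sum_eq_single j (fun b _ hb => by simp [F, hb]) (by simp)]
    simp only [F, Sum.elim_inl, Pi.single_eq_same]
    exact inv_mul_cancel₀ (natCast_zmod_sub_ne_zero (Fin.lt_def.mp hj).ne (w j).2 (z j).2)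
  -- Now `w ≥ z` coordinatewise and `w ≠ z`, so the coordinate sum is strictly larger.
  · push Not at hlt
    have hsum : ∑ j, (z j : ℕ) < ∑ j, (w j : ℕ) := by
      obtain ⟨j, hj⟩ := Function.ne_iff.mp hw
      exact Finset.sum_lt_sum (fun j _ => hlt j)
        ⟨j, Finset.mem_univ j, lt_of_le_of_ne (hlt j) fun h => hj (Fin.ext h.symm)⟩
    obtain ⟨i, hi⟩ := hℓ (Sum.inr ⟨∑ j, (w j : ℕ) - ∑ j, (z j : ℕ) - 1, by omega⟩)
    refine ⟨i, ?_⟩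
    have hcast : ((∑ j, (w j : ℕ) - ∑ j, (z j : ℕ) - 1 + 1 : ℕ) : ZMod p) =
        ∑ j, (((w j : ℕ) : ZMod p) - ((z j : ℕ) : ZMod p)) := by
      rw [Nat.sub_add_cancel (by omega), Nat.cast_sub hsum.le]
      simp
    rw [hi]
    simp only [F, Sum.elim_inr]
    rw [← Finset.mul_sum, ← hcast]
    refine inv_mul_cancel₀ ?_
    simpa using natCast_zmod_sub_ne_zero (p := p)
      (a := ∑ j, (w j : ℕ) - ∑ j, (z j : ℕ) - 1 + 1) (b := 0) (by omega) (by omega) (by omega)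

end Cover

/-! ### Bounds for `Φ_{k,M}`. -/

section UpperBound

lemma sum_lt_of_progressionIndex {p M k : ℕ} (z : progressionIndex p k M) :
    ∑ j, ((z : Fin M → Fin p) j : ℕ) < k := by
  simpa [progressionIndex] using z.2

variable {p : ℕ} [Fact p.Prime] {M k n : ℕ}

lemma norm_systemAverage_progressionSystem_le (hkp : k ≤ p)
    (f : progressionIndex p k M → (Fin n → ZMod p) → ℂ) (hf : ∀ z, OneBounded (f z))
    (z : progressionIndex p k M) :
    ‖systemAverage (progressionSystem p k M) f‖ ≤ gowersNorm (k - 1) (f z) := by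
  have hz := sum_lt_of_progressionIndex z
  -- This excess reaches every weight up to `k - 1`; it is below `p` because `k ≤ p`.
  obtain ⟨ℓ, hℓ⟩ := exists_hyperplane_cover (d := k - 1) (z : Fin M → Fin p)
    (k - 1 - ∑ j, ((z : Fin M → Fin p) j : ℕ)) (by omega) (by omega)
  refine norm_systemAverage_le_of_structured
    (fun (w : progressionIndex p k M) j => (((w : Fin M → Fin p) j : ℕ) : ZMod p)) f z
    (structured_dualFunction _ f z ℓ fun w hw => Or.inr ⟨hf w, hℓ w ?_ ?_⟩)
  · exact fun h => hw (Subtype.ext h)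
  · have := sum_lt_of_progressionIndex w
    omega

lemma norm_systemAverage_progressionSystem_pow_le
    (f : progressionIndex p k M → (Fin n → ZMod p) → ℂ) (hf : ∀ z, OneBounded (f z))
    (z : progressionIndex p k M) :
    ‖systemAverage (progressionSystem p k M) f‖ ^ 2 ^ ((progressionIndex p k M).card - 1) ≤
      gowersNorm (k - 1) (f z) := by
  have := norm_systemAverage_le_of_cover (d := k - 1)
    (fun (w : progressionIndex p k M) j => (((w : Fin M → Fin p) j : ℕ) : ZMod p))
    (fun w => ∑ j, ((w : Fin M → Fin p) j : ℕ)) (fun z => ?_) Finset.univ f hf (by simp) z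
    (Finset.mem_univ z)
  · rwa [Finset.card_univ, Fintype.card_coe] at this
  · have hz := sum_lt_of_progressionIndex z
    -- With excess 0 only the coordinate hyperplanes are used, so the size of `k` relative to `p` is
    -- irrelevant.
    obtain ⟨ℓ, hℓ⟩ := exists_hyperplane_cover (d := k - 1) (z : Fin M → Fin p) 0
      (Fact.out : p.Prime).pos (by omega)
    exact ⟨ℓ, fun w hw hwt => hℓ w (fun h => hw (Subtype.ext h)) hwt⟩

/-- The average over the system `Φ_{k,M}` is controlled by a power of the `U^{k-1}` norm. -/
theorem exists_norm_systemAverage_progressionSystem_le (hk : 1 ≤ k) :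
    ∃ c : ℝ, 0 < c ∧ c ≤ 1 ∧ (k ≤ p → c = 1) ∧
      (p < k → c = (2 : ℝ) ^ ((1 : ℝ) - ((progressionIndex p k M).card : ℝ))) ∧
      ∀ (n : ℕ) (f : progressionIndex p k M → (Fin n → ZMod p) → ℂ),
        (∀ z, OneBounded (f z)) →
          ∀ z, ‖systemAverage (progressionSystem p k M) f‖ ≤ gowersNorm (k - 1) (f z) ^ c := by
  rcases le_or_gt k p with hkp | hkp
  · refine ⟨1, one_pos, le_rfl, fun _ => rfl, fun h => absurd h hkp.not_gt, fun n f hf z => ?_⟩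
    rw [Real.rpow_one]
    exact norm_systemAverage_progressionSystem_le hkp f hf z
  · have hp0 : 0 < p := (Fact.out : p.Prime).pos
    have hcard : 1 ≤ (progressionIndex p k M).card :=
      Finset.card_pos.mpr ⟨fun _ => ⟨0, hp0⟩, by simp [progressionIndex]; omega⟩
    refine ⟨_, Real.rpow_pos_of_pos two_pos _, ?_, fun h => absurd h hkp.not_ge, fun _ => rfl,
      fun n f hf z => ?_⟩
    · refine Real.rpow_le_one_of_one_le_of_nonpos one_le_two ?_
      rw [sub_nonpos]
      exact_mod_cast hcard
    · have h := norm_systemAverage_progressionSystem_pow_le f hf z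
      have hc : (2 : ℝ) ^ ((1 : ℝ) - ((progressionIndex p k M).card : ℝ)) =
          ((2 ^ ((progressionIndex p k M).card - 1) : ℕ) : ℝ)⁻¹ := by
        push_cast
        rw [← Real.rpow_natCast, Nat.cast_sub hcard, ← Real.rpow_neg two_pos.le]
        simp
      rw [hc, Real.le_rpow_inv_iff_of_pos (norm_nonneg _) (gowersNorm_nonneg _ _) (by positivity),
        Real.rpow_natCast]
      exact h

lemma trueComplexityAtMost_progressionSystem (hk : 2 ≤ k) :
    TrueComplexityAtMost (progressionSystem p k M) (k - 2) := by
  obtain ⟨c, hc, -, -, -, h⟩ :=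
    exists_norm_systemAverage_progressionSystem_le (p := p) (M := M) (k := k) (by omega)
  refine ⟨fun δ => δ ^ c, fun δ hδ => Real.rpow_pos_of_pos hδ c, Real.zero_rpow hc.ne', ?_,
    fun n f hf z => ?_⟩
  · have := (Real.continuousAt_rpow_const 0 c (Or.inr hc.le)).tendsto
    rw [Real.zero_rpow hc.ne'] at this
    exact this.mono_left nhdsWithin_le_nhds
  · rw [show k - 2 + 1 = k - 1 by omega]
    exact h n f hf z

end UpperBound

/-! ### Strict triangle inequality and multiplicativity of Gowers norms. -/

section Tensor

lemma norm_expect_lt_one {ι : Type*} [Fintype ι] {f : ι → ℂ} (hf : ∀ i, ‖f i‖ ≤ 1) {a b : ι}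
    (hab : f a ≠ f b) : ‖𝔼 i, f i‖ < 1 := by
  set u := 𝔼 i, f i with hu
  have hu1 : ‖u‖ ≤ 1 := norm_expect_le_one hf
  have hre : ∀ z : ℂ, ‖z - u‖ ^ 2 = ‖z‖ ^ 2 + ‖u‖ ^ 2 - 2 * (starRingEnd ℂ u * z).re := by
    intro z
    simp only [← Complex.normSq_eq_norm_sq, Complex.normSq_apply, Complex.sub_re, Complex.sub_im,
      Complex.mul_re, Complex.conj_re, Complex.conj_im]
    ring
  have hle : ∀ i, (starRingEnd ℂ u * f i).re ≤ 1 := by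
    intro i
    refine (Complex.re_le_norm _).trans ?_
    rw [norm_mul, RCLike.norm_conj]
    exact mul_le_one₀ hu1 (norm_nonneg _) (hf i)
  have heq : ∀ i, ¬ (starRingEnd ℂ u * f i).re < 1 → f i = u := by
    intro i hi
    have h1 := hre (f i)
    have h2 : ‖f i‖ ^ 2 ≤ 1 := pow_le_one₀ (norm_nonneg _) (hf i)
    have h3 : ‖u‖ ^ 2 ≤ 1 := pow_le_one₀ (norm_nonneg _) hu1
    have h4 : ‖f i - u‖ ^ 2 ≤ 0 := by linarith [not_lt.mp hi]
    exact sub_eq_zero.mp (norm_eq_zero.mp (pow_eq_zero_iff two_ne_zero |>.mp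
      (le_antisymm h4 (by positivity))))
  have hlt : 𝔼 i, (starRingEnd ℂ u * f i).re < 1 := by
    refine Finset.expect_lt (fun i _ => hle i) ?_
    by_contra! hcon
    exact hab ((heq a (hcon a (Finset.mem_univ a)).not_gt).trans
      (heq b (hcon b (Finset.mem_univ b)).not_gt).symm)
  have hsq : ((‖u‖ ^ 2 : ℝ) : ℂ) = 𝔼 i, starRingEnd ℂ u * f i := by
    rw [← Finset.mul_expect, ← hu, mul_comm, Complex.mul_conj, Complex.normSq_eq_norm_sq]
  have hsq' : ‖u‖ ^ 2 = 𝔼 i, (starRingEnd ℂ u * f i).re := by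
    rw [← Complex.ofReal_re (‖u‖ ^ 2), hsq]
    exact map_expect (Complex.reLm.restrictScalars ℚ≥0) _ _
  by_contra! hcon
  have : 1 ≤ ‖u‖ ^ 2 := one_le_pow₀ hcon
  linarith

variable {G H : Type*} [AddCommGroup G] [Fintype G] [AddCommGroup H] [Fintype H]

lemma gowersAverage_comp_addEquiv (e : G ≃+ H) (d : ℕ) (f : H → ℂ) :
    gowersAverage d (fun x => f (e x)) = gowersAverage d f := by
  induction d generalizing f with
  | zero => exact Fintype.expect_equiv e.toEquiv _ _ fun _ => rfl
  | succ d ih =>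
    refine Fintype.expect_equiv e.toEquiv _ _ fun h => ?_
    rw [← ih]
    congr 1
    ext x
    simp [multDeriv]

lemma expect_pi_prod {X : Type*} [Fintype X] {N : ℕ} (F : Fin N → X → ℂ) :
    𝔼 x : Fin N → X, ∏ b, F b (x b) = ∏ b, 𝔼 y, F b y := by
  simp_rw [Fintype.expect_eq_sum_div_card, Finset.prod_div_distrib, Finset.prod_univ_sum,
    Fintype.piFinset_univ]
  simp

lemma gowersAverage_pi_prod {N : ℕ} (d : ℕ) (f : Fin N → G → ℂ) :
    gowersAverage d (fun x : Fin N → G => ∏ b, f b (x b)) = ∏ b, gowersAverage d (f b) := by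
  induction d generalizing f with
  | zero => exact expect_pi_prod f
  | succ d ih =>
    simp_rw [gowersAverage]
    rw [← expect_pi_prod]
    refine Finset.expect_congr rfl fun h _ => ?_
    rw [← ih]
    congr 1
    ext x
    simp [multDeriv, Finset.prod_mul_distrib]

lemma gowersNorm_pi_prod {N : ℕ} (d : ℕ) (f : G → ℂ) :
    gowersNorm d (fun x : Fin N → G => ∏ b, f (x b)) = gowersNorm d f ^ N := by
  rw [gowersNorm_eq, gowersNorm_eq, gowersAverage_pi_prod d fun _ => f]
  simp only [Finset.prod_const, Finset.card_univ, Fintype.card_fin, norm_pow]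
  rw [← Real.rpow_natCast, ← Real.rpow_mul (norm_nonneg _), mul_comm, Real.rpow_mul (norm_nonneg _),
    Real.rpow_natCast]

lemma gowersNorm_comp_addEquiv (e : G ≃+ H) (d : ℕ) (f : H → ℂ) :
    gowersNorm d (fun x => f (e x)) = gowersNorm d f := by
  rw [gowersNorm_eq, gowersNorm_eq, gowersAverage_comp_addEquiv]

end Tensor

/-! ### Gowers norms of monomial phases. -/

section MonomialPhase

variable {p : ℕ} [Fact p.Prime]

lemma norm_stdAddChar (x : ZMod p) : ‖(ZMod.stdAddChar x : ℂ)‖ = 1 :=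
  AddChar.norm_apply _ _

lemma addChar_map_sum {A R ι : Type*} [AddCommMonoid A] [CommMonoid R] (ψ : AddChar A R)
    (s : Finset ι) (f : ι → A) : ψ (∑ i ∈ s, f i) = ∏ i ∈ s, ψ (f i) :=
  map_prod ψ.toMonoidHom (fun i => Multiplicative.ofAdd (f i)) s

/-- The phase of the monomial `x₁ ⋯ x_r`. -/
def monomialPhase (p : ℕ) [Fact p.Prime] (r : ℕ) (x : Fin r → ZMod p) : ℂ :=
  ZMod.stdAddChar (∏ i, x i)

/-- The norm is a root of the modulus of an average of unimodular terms, so two distinct terms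
suffice. No comparison of `r` with `p` is needed, since the monomial is multilinear. -/
lemma gowersNorm_monomialPhase_lt_one {r : ℕ} (hr : 0 < r) :
    gowersNorm r (monomialPhase p r) < 1 := by
  have hne : Nonempty (Fin r) := ⟨⟨0, hr⟩⟩
  rw [gowersNorm_eq]
  refine Real.rpow_lt_one (norm_nonneg _) ?_ (by positivity)
  rw [gowersAverage_eq]
  set T : (Fin r → ZMod p) → (Fin r → Fin r → ZMod p) → ℂ := fun x h =>
    ∏ ω : Finset (Fin r), (starRingEnd ℂ)^[ω.card] (monomialPhase p r (x + ∑ i ∈ ω, h i)) with hT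
  have hconj : ∀ (m : ℕ) (z : ℂ), ‖(starRingEnd ℂ)^[m] z‖ = ‖z‖ := by
    intro m z
    induction m with
    | zero => rfl
    | succ m ih => rw [Function.iterate_succ_apply', RCLike.norm_conj, ih]
  have hconj1 : ∀ m : ℕ, (starRingEnd ℂ)^[m] 1 = 1 := fun m => iterate_map_one _ m
  have h0 : T 0 0 = 1 := by
    simp [hT, monomialPhase, hconj1, hr.ne']
  have h1 : T 0 (fun i => Pi.single i 1) ≠ 1 := by
    have hsum : ∀ (ω : Finset (Fin r)) (i : Fin r),
        (∑ j ∈ ω, (Pi.single j 1 : Fin r → ZMod p)) i = if i ∈ ω then 1 else 0 := by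
      intro ω i
      simp [Finset.sum_apply, Pi.single_apply]
    -- At vertices of the unit cube the monomial is nonzero only at the all-ones vertex.
    have hval : T 0 (fun i => Pi.single i 1) =
        (starRingEnd ℂ)^[r] (ZMod.stdAddChar (1 : ZMod p)) := by
      simp only [hT]
      rw [Finset.prod_eq_single Finset.univ]
      · simp only [monomialPhase, zero_add, hsum]
        simp
      · intro ω _ hω
        obtain ⟨i, hi⟩ : ∃ i, i ∉ ω := by
          by_contra! hcon
          exact hω (Finset.eq_univ_of_forall hcon)
        have : ∏ i, (∑ j ∈ ω, (Pi.single j 1 : Fin r → ZMod p)) i = 0 :=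
          Finset.prod_eq_zero (Finset.mem_univ i) (by simp [hsum, hi])
        simp only [monomialPhase, zero_add, this, AddChar.map_zero_eq_one, hconj1]
      · simp
    rw [hval]
    intro h
    have hinj : Function.Injective ((starRingEnd ℂ)^[r]) :=
      (starRingEnd ℂ).injective.iterate r
    have h2 : ZMod.stdAddChar (1 : ZMod p) = (1 : ℂ) := hinj (h.trans (hconj1 r).symm)
    rw [← AddChar.map_zero_eq_one (ZMod.stdAddChar (N := p))] at h2
    exact one_ne_zero (ZMod.injective_stdAddChar h2)
  rw [← Finset.expect_product' (f := T), Finset.univ_product_univ]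
  refine norm_expect_lt_one (f := fun q : (Fin r → ZMod p) × (Fin r → Fin r → ZMod p) => T q.1 q.2)
    (fun q => ?_) (a := (0, 0)) (b := (0, fun i => Pi.single i 1)) (by rw [h0]; exact h1.symm)
  simp only [hT, norm_prod, hconj]
  exact Finset.prod_le_one (fun _ _ => norm_nonneg _) fun _ _ => (norm_stdAddChar _).le

end MonomialPhase

/-! ### Forward differences annihilate low-degree polynomials. -/

section Relation

variable {p : ℕ} [Fact p.Prime] {M : ℕ}

/-- The coefficients of the iterated forward difference of order `a`. -/
def differenceCoeff (a z : Fin M → Fin p) : ZMod p :=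
  ∏ j, (-1) ^ ((a j : ℕ) - (z j : ℕ)) * (((a j : ℕ).choose (z j : ℕ) : ℕ) : ZMod p)

lemma differenceCoeff_self (a : Fin M → Fin p) : differenceCoeff a a = 1 := by
  simp [differenceCoeff]

lemma sum_choose_mul_pow_eq_zero {a m : ℕ} (ha : a < p) (hm : m < a) :
    ∑ x : Fin p, ((-1) ^ (a - (x : ℕ)) * ((a.choose (x : ℕ) : ℕ) : ZMod p)) *
      ((x : ℕ) : ZMod p) ^ m = 0 := by
  have h := congrFun (fwdDiff_iter_pow_eq_zero_of_lt (R := ZMod p) hm) 0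
  rw [fwdDiff_iter_eq_sum_shift] at h
  rw [Fin.sum_univ_eq_sum_range (fun x : ℕ => ((-1) ^ (a - x) * ((a.choose x : ℕ) : ZMod p)) *
    (x : ZMod p) ^ m) p, ← Finset.sum_subset (Finset.range_mono ha)]
  · simpa using h
  · intro x _ hx
    rw [Nat.choose_eq_zero_of_lt (by simpa using hx)]
    simp

lemma sum_differenceCoeff_mul_prod_eq_zero (a : Fin M → Fin p) {r : ℕ}
    (hr : r < ∑ j, (a j : ℕ)) (τ : Fin r → Fin (M + 1)) :
    ∑ z : Fin M → Fin p, differenceCoeff a z *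
      ∏ i, (Fin.cons 1 (fun j => ((z j : ℕ) : ZMod p)) : Fin (M + 1) → ZMod p) (τ i) = 0 := by
  set m : Fin M → ℕ := fun j => (Finset.univ.filter fun i => τ i = j.succ).card with hm
  have hprod : ∀ z : Fin M → Fin p,
      ∏ i, (Fin.cons 1 (fun j => ((z j : ℕ) : ZMod p)) : Fin (M + 1) → ZMod p) (τ i) =
        ∏ j, ((z j : ℕ) : ZMod p) ^ m j := by
    intro z
    rw [← Finset.prod_fiberwise Finset.univ τ, Fin.prod_univ_succ]
    have : ∀ l, ∏ i with τ i = l,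
        (Fin.cons 1 (fun j => ((z j : ℕ) : ZMod p)) : Fin (M + 1) → ZMod p) (τ i) =
        (Fin.cons 1 (fun j => ((z j : ℕ) : ZMod p)) : Fin (M + 1) → ZMod p) l ^
          (Finset.univ.filter fun i => τ i = l).card := by
      intro l
      rw [← Finset.prod_const]
      exact Finset.prod_congr rfl fun i hi => by rw [(Finset.mem_filter.mp hi).2]
    simp only [this, Fin.cons_zero, Fin.cons_succ, one_pow, one_mul, hm]
  -- The total degree is at most `r < ∑ a j`, so in some coordinate the difference has higher order
  -- than the exponent.
  obtain ⟨j, hj⟩ : ∃ j, m j < a j := by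
    by_contra! hcon
    have h1 : ∑ j, m j ≤ r := by
      have := Finset.card_eq_sum_card_fiberwise (f := τ) (s := Finset.univ) (t := Finset.univ)
        (by simp)
      rw [Fin.sum_univ_succ, Finset.card_univ, Fintype.card_fin] at this
      simp only [hm]
      omega
    have h2 : ∑ j, (a j : ℕ) ≤ ∑ j, m j := Finset.sum_le_sum fun j _ => hcon j
    omega
  simp_rw [hprod, differenceCoeff, ← Finset.prod_mul_distrib]
  have := Finset.prod_univ_sum (fun _ : Fin M => (Finset.univ : Finset (Fin p)))
    fun j x => ((-1) ^ ((a j : ℕ) - (x : ℕ)) * (((a j : ℕ).choose (x : ℕ) : ℕ) : ZMod p)) *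
      ((x : ℕ) : ZMod p) ^ m j
  rw [Fintype.piFinset_univ] at this
  rw [← this]
  exact Finset.prod_eq_zero (Finset.mem_univ j) (sum_choose_mul_pow_eq_zero (a j).2 hj)

/-- The coefficients vanish unless `z ≤ a` coordinatewise, so the sum extends to the whole box; the
product then expands into monomials in `z` of degree at most `r`. -/
lemma sum_progressionIndex_differenceCoeff_eq_zero {k : ℕ} (a : Fin M → Fin p)
    (ha : ∑ j, (a j : ℕ) < k) {r : ℕ} (hr : r < ∑ j, (a j : ℕ)) (x : Fin (M + 1) → Fin r → ZMod p) :
    ∑ z : progressionIndex p k M, differenceCoeff a z *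
      ∏ i, ∑ j, progressionSystem p k M z j * x j i = 0 := by
  have h1 : ∑ z : progressionIndex p k M, differenceCoeff a z *
      ∏ i, ∑ j, progressionSystem p k M z j * x j i = ∑ z : Fin M → Fin p, differenceCoeff a z *
      ∏ i, ∑ j, (Fin.cons 1 (fun j => ((z j : ℕ) : ZMod p)) : Fin (M + 1) → ZMod p) j * x j i := by
    have h2 := Finset.sum_coe_sort (progressionIndex p k M) fun z => differenceCoeff a z *
      ∏ i, ∑ j, (Fin.cons 1 (fun j => ((z j : ℕ) : ZMod p)) : Fin (M + 1) → ZMod p) j * x j i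
    refine h2.trans (Finset.sum_subset (Finset.subset_univ _) fun z _ hz => ?_)
    have hz' : k ≤ ∑ j, (z j : ℕ) := by simpa [progressionIndex] using hz
    obtain ⟨j, hj⟩ : ∃ j, (a j : ℕ) < z j := by
      by_contra! hcon
      exact absurd (Finset.sum_le_sum fun j (_ : j ∈ Finset.univ) => hcon j) (by omega)
    have : differenceCoeff a z = 0 :=
      Finset.prod_eq_zero (Finset.mem_univ j) (by rw [Nat.choose_eq_zero_of_lt hj]; simp)
    rw [this, zero_mul]
  rw [h1]
  simp_rw [Finset.prod_univ_sum, Finset.mul_sum, Finset.prod_mul_distrib]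
  rw [Finset.sum_comm]
  refine Finset.sum_eq_zero fun τ _ => ?_
  simp_rw [← mul_assoc]
  rw [← Finset.sum_mul, sum_differenceCoeff_mul_prod_eq_zero a hr τ, zero_mul]

end Relation

/-! ### Optimality of the complexity. -/

section LowerBound

lemma exists_sum_eq_of_le_mul {q : ℕ} (M m : ℕ) (h : m ≤ M * q) :
    ∃ a : Fin M → ℕ, (∀ j, a j ≤ q) ∧ ∑ j, a j = m := by
  induction M generalizing m with
  | zero => exact ⟨fun _ => 0, by simp, by simpa [eq_comm] using h⟩
  | succ M ih =>
    obtain ⟨a, ha, hs⟩ := ih (m - min m q) (by rw [add_mul] at h; omega)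
    refine ⟨Fin.cons (min m q) a, fun j => ?_, ?_⟩
    · refine Fin.cases ?_ (fun j => ?_) j
      · simp
      · simpa using ha j
    · rw [Fin.sum_univ_succ]
      simp only [Fin.cons_zero, Fin.cons_succ, hs]
      omega

variable {p : ℕ} [Fact p.Prime] {M k : ℕ}

/-- Grouping `N * r` coordinates into `N` blocks of length `r`. -/
def blockEquiv (p N r : ℕ) : (Fin (N * r) → ZMod p) ≃ₗ[ZMod p] (Fin N → Fin r → ZMod p) :=
  (LinearEquiv.funCongrLeft (ZMod p) (ZMod p) finProdFinEquiv).trans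
    (LinearEquiv.curry (ZMod p) (ZMod p) (Fin N) (Fin r))

/-- If `r < k - 1` then the average over `Φ_{k,M}` is not controlled by the `U^r` norm: phases of
polynomials of degree `r` give an average of `1`. -/
lemma exists_systemAverage_eq_one {r : ℕ} (hr : r + 1 < k) (hkM : k ≤ M * (p - 1) + 1) (N : ℕ) :
    ∃ f : progressionIndex p k M → (Fin (N * r) → ZMod p) → ℂ, (∀ z, OneBounded (f z)) ∧
      systemAverage (progressionSystem p k M) f = 1 ∧
      ∃ z, gowersNorm r (f z) = gowersNorm r (monomialPhase p r) ^ N := by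
  -- The bound on `k` is exactly what lets a point of the box have weight `k - 1`.
  obtain ⟨a', ha', hsum'⟩ := exists_sum_eq_of_le_mul (q := p - 1) M (k - 1) (by omega)
  have hp0 : 0 < p := (Fact.out : p.Prime).pos
  set a : Fin M → Fin p := fun j => ⟨a' j, by have := ha' j; omega⟩ with ha
  have hsum : ∑ j, (a j : ℕ) = k - 1 := hsum'
  have hmem : a ∈ progressionIndex p k M := by
    simp only [progressionIndex, Finset.mem_filter, Finset.mem_univ, true_and, hsum]
    omega
  refine ⟨fun z x => ZMod.stdAddChar (differenceCoeff a z * ∑ b, ∏ i, blockEquiv p N r x b i),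
    fun z x => (norm_stdAddChar _).le, ?_, ⟨a, hmem⟩, ?_⟩
  · rw [systemAverage, ← Fintype.expect_one (M := ℂ) (ι := Fin (M + 1) → Fin (N * r) → ZMod p)]
    refine Finset.expect_congr rfl fun x _ => ?_
    rw [← addChar_map_sum, ← AddChar.map_zero_eq_one (ZMod.stdAddChar (N := p))]
    congr 1
    simp_rw [Finset.mul_sum]
    rw [Finset.sum_comm]
    refine Finset.sum_eq_zero fun b _ => ?_
    rw [← sum_progressionIndex_differenceCoeff_eq_zero (k := k) a (by omega) (r := r) (by omega)
      fun j => blockEquiv p N r (x j) b]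
    simp
  · rw [← gowersNorm_pi_prod, ← gowersNorm_comp_addEquiv (blockEquiv p N r).toAddEquiv]
    congr 1
    ext x
    simp [differenceCoeff_self, monomialPhase, addChar_map_sum]

lemma le_of_trueComplexityAtMost_progressionSystem (hkM : k ≤ M * (p - 1) + 1) {s : ℕ}
    (h : TrueComplexityAtMost (progressionSystem p k M) s) : k - 2 ≤ s := by
  by_contra! hs
  obtain ⟨ε, -, h0, hlim, hε⟩ := h
  set ρ := gowersNorm (s + 1) (monomialPhase p (s + 1)) with hρ
  have hρ1 : ρ < 1 := gowersNorm_monomialPhase_lt_one s.succ_pos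
  have hρ0 : 0 ≤ ρ := gowersNorm_nonneg _ _
  have hge : ∀ N : ℕ, 1 ≤ ε (ρ ^ N) := by
    intro N
    obtain ⟨f, hf, hΛ, z, hz⟩ :=
      exists_systemAverage_eq_one (p := p) (M := M) (k := k) (r := s + 1) (by omega) hkM N
    have := hε _ f hf z
    rwa [hΛ, norm_one, hz] at this
  -- For `ρ = 0` the limit from the right says nothing, and the value `ε 0 = 0` is used instead.
  rcases hρ0.eq_or_lt with h | hpos
  · have := hge 1
    rw [← h, pow_one, h0] at this
    linarith
  · have ht : Filter.Tendsto (fun N : ℕ => ρ ^ N) Filter.atTop (𝓝[>] 0) :=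
      tendsto_nhdsWithin_iff.mpr ⟨tendsto_pow_atTop_nhds_zero_of_lt_one hρ0 hρ1,
        Filter.Eventually.of_forall fun N => pow_pos hpos N⟩
    have := ge_of_tendsto' (hlim.comp ht) hge
    linarith

end LowerBound

end

theorem mainTheorem2 (p : ℕ) [Fact p.Prime] (M k : ℕ) (hk : 1 ≤ k) (hkM : k ≤ M * (p - 1) + 1) :
    (2 ≤ k → HasTrueComplexity (progressionSystem p k M) (k - 2)) ∧
    ∃ c : ℝ, 0 < c ∧ c ≤ 1 ∧
      (k ≤ p → c = 1) ∧
      (p < k → c = (2 : ℝ) ^ ((1 : ℝ) - ((progressionIndex p k M).card : ℝ))) ∧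
      ∀ (n : ℕ) (f : progressionIndex p k M → (Fin n → ZMod p) → ℂ),
        (∀ z, OneBounded (f z)) →
          ∀ z, ‖systemAverage (progressionSystem p k M) f‖ ≤ gowersNorm (k - 1) (f z) ^ c :=
  ⟨fun hk2 => ⟨trueComplexityAtMost_progressionSystem hk2,
    fun _ hs => le_of_trueComplexityAtMost_progressionSystem hkM hs⟩,
    exists_norm_systemAverage_progressionSystem_le hk⟩
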